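/- Let $\mathbb D=\{z\in\mathbb C:|z|<1\}$ and let $\mathcal S_1$ be the set of holomorphic functions $s:\mathbb D\to\overline{\mathbb D}$ with $s'(0)=0$. Let $z_0,z_1\in\mathbb D$ be nonzero points, let $w_1\in\mathbb C$ with $|w_1|\le 1$, and let $$\mathcal B_{z_0}=\{\,s(z_0)\colon s\in\mathcal S_1,\ s(z_1)=w_1\,\}$$ be the interpolation body. Put $$c=\frac{w_1(1-|z_1|^4)}{1-|z_1|^4|w_1|^2},\qquad r=\frac{|z_1|^2(1-|w_1|^2)}{1-|z_1|^4|w_1|^2},\qquad \delta_0=1-|z_0|^2,$$ and for $x\in\mathbb C$ $$\mathbb P'_x=\begin{bmatrix}1-|x|^2&0&1-\overline{w_1}x\\0&1-|x|^2&\overline{z_1}(1-\overline{w_1}x)\\1-w_1\overline x&z_1(1-w_1\overline x)&\frac{1-|w_1|^2}{1-|z_1|^2}\end{bmatrix},$$ $$E=\delta_0^{1/2}\begin{bmatrix}1\\\overline{z_0}\\\frac1{1-\overline{z_0}z_1}\end{bmatrix},\qquad W_x=\delta_0^{1/2}\begin{bmatrix}-x\\-\overline{z_0}x\\-\frac{w_1}{1-\overline{z_0}z_1}\end{bmatrix}.$$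 Then, for every $x$ in the open disk $\mathbb D(c,r)=\{x\in\mathbb C:|x-c|<r\}$ (empty if $r=0$), the matrix $\mathbb P'_x+W_xW_x^*$ is invertible. For such $x$ define $$c_x=-E^*(\mathbb P'_x+W_xW_x^*)^{-1}W_x,\qquad \ell_x=1-W_x^*(\mathbb P'_x+W_xW_x^*)^{-1}W_x,$$ $$r_x=1-E^*(\mathbb P'_x+W_xW_x^*)^{-1}E,\qquad R_x=\ell_x^{1/2}r_x^{1/2}.$$ Then $$\bigcup_{x\in\mathbb D(c,r),\ r_x>0}\{w\in\mathbb C\colon |w-c_x|\le R_x\}\subseteq\mathcal B_{z_0}.$$ -/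

import Mathlib

open scoped Matrix

namespace ConstrainedInterpolation

/-- The constrained Schur class: holomorphic maps of the open unit disk into the closed unit disk
whose derivative vanishes at the origin. -/
def schurClassOne : Set (ℂ → ℂ) :=
  {s | DifferentiableOn ℂ s (Metric.ball 0 1) ∧ (∀ z ∈ Metric.ball (0 : ℂ) 1, ‖s z‖ ≤ 1) ∧
    deriv s 0 = 0}

/-- The interpolation body at `z₀`: all values `s z₀`, where `s` runs over the functions of the
constrained Schur class with `s z₁ = w₁`. -/
def interpolationBody (z₁ w₁ z₀ : ℂ) : Set ℂ :=
  {w₀ | ∃ s ∈ schurClassOne, s z₁ = w₁ ∧ s z₀ = w₀}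

/-- The center `c` of the parameter disk. -/
noncomputable def paramCenter (z₁ w₁ : ℂ) : ℂ :=
  w₁ * (1 - (‖z₁‖ : ℂ) ^ 4) / (1 - (‖z₁‖ : ℂ) ^ 4 * (‖w₁‖ : ℂ) ^ 2)

/-- The radius `r` of the parameter disk. -/
noncomputable def paramRadius (z₁ w₁ : ℂ) : ℝ :=
  ‖z₁‖ ^ 2 * (1 - ‖w₁‖ ^ 2) / (1 - ‖z₁‖ ^ 4 * ‖w₁‖ ^ 2)

/-- The matrix `P'ₓ`. -/
noncomputable def pickMatrix (z₁ w₁ x : ℂ) : Matrix (Fin 3) (Fin 3) ℂ :=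
  !![1 - (‖x‖ : ℂ) ^ 2, 0, 1 - star w₁ * x;
     0, 1 - (‖x‖ : ℂ) ^ 2, star z₁ * (1 - star w₁ * x);
     1 - w₁ * star x, z₁ * (1 - w₁ * star x),
       (1 - (‖w₁‖ : ℂ) ^ 2) / (1 - (‖z₁‖ : ℂ) ^ 2)]

/-- The number `δ₀ ^ (1/2)`, where `δ₀ = 1 - |z₀|²`. -/
noncomputable def sqrtDelta (z₀ : ℂ) : ℝ := √(1 - ‖z₀‖ ^ 2)

/-- The column vector `E`. -/
noncomputable def vecE (z₁ z₀ : ℂ) : Fin 3 → ℂ :=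
  (sqrtDelta z₀ : ℂ) • ![1, star z₀, 1 / (1 - star z₀ * z₁)]

/-- The column vector `Wₓ`. -/
noncomputable def vecW (z₁ w₁ z₀ x : ℂ) : Fin 3 → ℂ :=
  (sqrtDelta z₀ : ℂ) • ![-x, -(star z₀ * x), -(w₁ / (1 - star z₀ * z₁))]

/-- The matrix `P'ₓ + Wₓ Wₓ*`. -/
noncomputable def augMatrix (z₁ w₁ z₀ x : ℂ) : Matrix (Fin 3) (Fin 3) ℂ :=
  pickMatrix z₁ w₁ x + Matrix.vecMulVec (vecW z₁ w₁ z₀ x) (star (vecW z₁ w₁ z₀ x))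

/-- The center `cₓ = -E* (P'ₓ + Wₓ Wₓ*)⁻¹ Wₓ`. -/
noncomputable def diskCenter (z₁ w₁ z₀ x : ℂ) : ℂ :=
  -(star (vecE z₁ z₀) ⬝ᵥ ((augMatrix z₁ w₁ z₀ x)⁻¹ *ᵥ vecW z₁ w₁ z₀ x))

/-- The number `ℓₓ = 1 - Wₓ* (P'ₓ + Wₓ Wₓ*)⁻¹ Wₓ`. It is real (see `ofReal_ell`), so it is
recorded through its real part. -/
noncomputable def ell (z₁ w₁ z₀ x : ℂ) : ℝ :=
  (1 - star (vecW z₁ w₁ z₀ x) ⬝ᵥ ((augMatrix z₁ w₁ z₀ x)⁻¹ *ᵥ vecW z₁ w₁ z₀ x)).re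

/-- The number `rₓ = 1 - E* (P'ₓ + Wₓ Wₓ*)⁻¹ E`. It is real (see `ofReal_rho`), so it is
recorded through its real part. -/
noncomputable def rho (z₁ w₁ z₀ x : ℂ) : ℝ :=
  (1 - star (vecE z₁ z₀) ⬝ᵥ ((augMatrix z₁ w₁ z₀ x)⁻¹ *ᵥ vecE z₁ z₀)).re

/-- The radius `Rₓ = ℓₓ ^ (1/2) * rₓ ^ (1/2)`. -/
noncomputable def diskRadius (z₁ w₁ z₀ x : ℂ) : ℝ :=
  √(ell z₁ w₁ z₀ x) * √(rho z₁ w₁ z₀ x)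

theorem augMatrix_isHermitian (z₁ w₁ z₀ x : ℂ) : (augMatrix z₁ w₁ z₀ x).IsHermitian := by
  ext i j
  fin_cases i <;> fin_cases j <;>
    simp [augMatrix, pickMatrix, Matrix.vecMulVec_apply, mul_comm]

theorem im_quadForm_inv (z₁ w₁ z₀ x : ℂ) (v : Fin 3 → ℂ) :
    (star v ⬝ᵥ ((augMatrix z₁ w₁ z₀ x)⁻¹ *ᵥ v)).im = 0 :=
  (augMatrix_isHermitian z₁ w₁ z₀ x).inv.im_star_dotProduct_mulVec_self v

/-- The real number `ell` is the complex number `1 - Wₓ* (P'ₓ + Wₓ Wₓ*)⁻¹ Wₓ`. -/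
theorem ofReal_ell (z₁ w₁ z₀ x : ℂ) :
    (ell z₁ w₁ z₀ x : ℂ) =
      1 - star (vecW z₁ w₁ z₀ x) ⬝ᵥ ((augMatrix z₁ w₁ z₀ x)⁻¹ *ᵥ vecW z₁ w₁ z₀ x) := by
  apply Complex.ext
  · simp only [ell, Complex.ofReal_re]
  · rw [Complex.ofReal_im, Complex.sub_im, im_quadForm_inv]; simp

/-- The real number `rho` is the complex number `1 - E* (P'ₓ + Wₓ Wₓ*)⁻¹ E`. -/
theorem ofReal_rho (z₁ w₁ z₀ x : ℂ) :
    (rho z₁ w₁ z₀ x : ℂ) =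
      1 - star (vecE z₁ z₀) ⬝ᵥ ((augMatrix z₁ w₁ z₀ x)⁻¹ *ᵥ vecE z₁ z₀) := by
  apply Complex.ext
  · simp only [rho, Complex.ofReal_re]
  · rw [Complex.ofReal_im, Complex.sub_im, im_quadForm_inv]; simp

end ConstrainedInterpolation

namespace ConstrainedInterpolation

/-- The disk automorphism taking `0` to `a`. -/
noncomputable def moebius (a ζ : ℂ) : ℂ := (a + ζ) / (1 + star a * ζ)

theorem moebius_denom_sq_sub (a b : ℂ) :
    ‖1 - star a * b‖ ^ 2 - ‖b - a‖ ^ 2 = (1 - ‖a‖ ^ 2) * (1 - ‖b‖ ^ 2) := by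
  simp only [Complex.sq_norm, Complex.normSq_apply]
  simp
  ring

theorem one_add_star_mul_ne_zero {a ζ : ℂ} (ha : ‖a‖ < 1) (hζ : ‖ζ‖ ≤ 1) :
    1 + star a * ζ ≠ 0 := by
  intro h
  have h1 : ‖star a * ζ‖ = 1 := by
    rw [show star a * ζ = -1 by linear_combination h]; simp
  rw [norm_mul, norm_star] at h1
  nlinarith [norm_nonneg a, norm_nonneg ζ]

theorem norm_moebius_le_one {a ζ : ℂ} (ha : ‖a‖ < 1) (hζ : ‖ζ‖ ≤ 1) : ‖moebius a ζ‖ ≤ 1 := by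
  have hd := one_add_star_mul_ne_zero ha hζ
  rw [moebius, norm_div, div_le_one (norm_pos_iff.2 hd)]
  have h := moebius_denom_sq_sub (-a) ζ
  simp only [star_neg, neg_mul, sub_neg_eq_add, norm_neg] at h
  rw [add_comm a]
  refine le_of_sq_le_sq ?_ (norm_nonneg _)
  nlinarith [norm_nonneg a, norm_nonneg ζ, mul_nonneg (by nlinarith [norm_nonneg a] : 0 ≤ 1 - ‖a‖ ^ 2)
    (by nlinarith [norm_nonneg ζ] : 0 ≤ 1 - ‖ζ‖ ^ 2)]

theorem moebius_zero_right (a : ℂ) : moebius a 0 = a := by simp [moebius]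

/-- The automorphism `moebius a` sends `(w - a) / (1 - conj a * w)` to `w`. -/
theorem moebius_div {a w : ℂ} (ha : ‖a‖ < 1) (hw : 1 - star a * w ≠ 0) :
    moebius a ((w - a) / (1 - star a * w)) = w := by
  have hp : 1 - star a * a ≠ 0 := by
    have := one_add_star_mul_ne_zero (a := a) (ζ := -a) ha (by simpa using ha.le)
    simpa [sub_eq_add_neg] using this
  have hw' : 1 - w * star a ≠ 0 := by rwa [mul_comm]
  have h2 : 1 + star a * ((w - a) / (1 - star a * w)) ≠ 0 := by
    rw [show 1 + star a * ((w - a) / (1 - star a * w)) = (1 - star a * a) / (1 - star a * w) by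
      field_simp; ring]
    exact div_ne_zero hp hw
  rw [moebius, div_eq_iff h2]
  field_simp
  ring

theorem DifferentiableOn.moebius {a : ℂ} {f : ℂ → ℂ} {U : Set ℂ} (ha : ‖a‖ < 1)
    (hf : DifferentiableOn ℂ f U) (hb : ∀ z ∈ U, ‖f z‖ ≤ 1) :
    DifferentiableOn ℂ (fun z => moebius a (f z)) U := by
  unfold ConstrainedInterpolation.moebius
  exact (hf.const_add a).div ((hf.const_mul _).const_add 1)
    fun z hz => one_add_star_mul_ne_zero ha (hb z hz)

/-- Two-point Nevanlinna–Pick interpolation, the first value lying in the open disk. -/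
theorem exists_schur_two_point {z₁ z₀ γ₁ γ₀ : ℂ} (hz₁ : ‖z₁‖ < 1) (hz₀ : ‖z₀‖ < 1) (hγ₁ : ‖γ₁‖ < 1)
    (hγ : (1 - ‖z₁‖ ^ 2) * (1 - ‖z₀‖ ^ 2) * ‖1 - star γ₁ * γ₀‖ ^ 2 ≤
      (1 - ‖γ₁‖ ^ 2) * (1 - ‖γ₀‖ ^ 2) * ‖1 - star z₁ * z₀‖ ^ 2) :
    ∃ g : ℂ → ℂ, DifferentiableOn ℂ g (Metric.ball 0 1) ∧
      (∀ z ∈ Metric.ball (0 : ℂ) 1, ‖g z‖ ≤ 1) ∧ g z₁ = γ₁ ∧ g z₀ = γ₀ := by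
  have hz : ∀ z : ℂ, ‖z‖ < 1 → ‖moebius (-z₁) z‖ ≤ 1 := fun z hz =>
    norm_moebius_le_one (by simpa using hz₁) hz.le
  have hbd : DifferentiableOn ℂ (fun z => moebius (-z₁) z) (Metric.ball 0 1) :=
    DifferentiableOn.moebius (by simpa using hz₁) differentiableOn_id
      (fun z hz => by simpa using (mem_ball_zero_iff.1 hz).le)
  have hzd : 1 - star z₁ * z₀ ≠ 0 := by
    have := one_add_star_mul_ne_zero (a := -z₁) (ζ := z₀) (by simpa using hz₁) hz₀.le
    simpa [sub_eq_add_neg] using this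
  have hzn : 0 < ‖1 - star z₁ * z₀‖ ^ 2 := by positivity
  have p1 : 0 < 1 - ‖z₁‖ ^ 2 := by nlinarith [norm_nonneg z₁]
  have p0 : 0 < 1 - ‖z₀‖ ^ 2 := by nlinarith [norm_nonneg z₀]
  have q1 : 0 < 1 - ‖γ₁‖ ^ 2 := by nlinarith [norm_nonneg γ₁]
  have hγ₀ : 0 ≤ 1 - ‖γ₀‖ ^ 2 := by
    by_contra! hneg
    have : (1 - ‖γ₁‖ ^ 2) * (1 - ‖γ₀‖ ^ 2) * ‖1 - star z₁ * z₀‖ ^ 2 < 0 :=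
      mul_neg_of_neg_of_pos (mul_neg_of_pos_of_neg q1 hneg) hzn
    have : 0 ≤ (1 - ‖z₁‖ ^ 2) * (1 - ‖z₀‖ ^ 2) * ‖1 - star γ₁ * γ₀‖ ^ 2 := by positivity
    linarith
  have hγ₀' : ‖γ₀‖ ≤ 1 := by nlinarith [norm_nonneg γ₀]
  have hγd : 1 - star γ₁ * γ₀ ≠ 0 := by
    have := one_add_star_mul_ne_zero (a := -γ₁) (ζ := γ₀) (by simpa using hγ₁) hγ₀'
    simpa [sub_eq_add_neg] using this
  have hpseudo : ‖γ₀ - γ₁‖ * ‖1 - star z₁ * z₀‖ ≤ ‖z₀ - z₁‖ * ‖1 - star γ₁ * γ₀‖ := by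
    refine le_of_sq_le_sq ?_ (by positivity)
    rw [mul_pow, mul_pow]
    rw [← moebius_denom_sq_sub, ← moebius_denom_sq_sub] at hγ
    linarith
  set κ : ℂ := (γ₀ - γ₁) / (1 - star γ₁ * γ₀) / moebius (-z₁) z₀ with hκ
  have hm : moebius (-z₁) z₀ = (z₀ - z₁) / (1 - star z₁ * z₀) := by
    simp [moebius, sub_eq_add_neg, add_comm]
  have hκ1 : ‖κ‖ ≤ 1 := by
    rw [hκ, hm, norm_div, norm_div, norm_div]
    refine div_le_one_of_le₀ ?_ (by positivity)
    rw [div_le_div_iff₀ (by positivity) (by positivity)]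
    exact hpseudo
  have hκ2 : κ * moebius (-z₁) z₀ = (γ₀ - γ₁) / (1 - star γ₁ * γ₀) := by
    by_cases h0 : z₀ - z₁ = 0
    · have : γ₀ - γ₁ = 0 := by
        rw [h0, norm_zero, zero_mul] at hpseudo
        have := nonpos_of_mul_nonpos_left hpseudo (norm_pos_iff.2 hzd)
        exact norm_le_zero_iff.1 this
      simp [hκ, this]
    · rw [hκ, div_mul_cancel₀]
      rw [hm]
      exact div_ne_zero h0 hzd
  have hk : ∀ z ∈ Metric.ball (0 : ℂ) 1, ‖κ * moebius (-z₁) z‖ ≤ 1 := fun z hz' => by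
    rw [norm_mul]
    exact mul_le_one₀ hκ1 (norm_nonneg _) (hz z (mem_ball_zero_iff.1 hz'))
  refine ⟨fun z => moebius γ₁ (κ * moebius (-z₁) z),
    DifferentiableOn.moebius hγ₁ (hbd.const_mul κ) hk, fun z hz' => norm_moebius_le_one hγ₁ (hk z hz'),
    ?_, ?_⟩
  · have : moebius (-z₁) z₁ = 0 := by simp [moebius]
    simp only [this, mul_zero, moebius_zero_right]
  · simp only [hκ2]
    exact moebius_div hγ₁ hγd

/-- Multiplying a Schur function by `z ^ 2` and applying a disk automorphism gives a function of
the constrained Schur class. -/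
theorem moebius_sq_mul_mem_schurClassOne {x : ℂ} {g : ℂ → ℂ} (hx : ‖x‖ < 1)
    (hg : DifferentiableOn ℂ g (Metric.ball 0 1)) (hb : ∀ z ∈ Metric.ball (0 : ℂ) 1, ‖g z‖ ≤ 1) :
    (fun z => moebius x (z ^ 2 * g z)) ∈ schurClassOne := by
  have hk : ∀ z ∈ Metric.ball (0 : ℂ) 1, ‖z ^ 2 * g z‖ ≤ 1 := fun z hz => by
    rw [norm_mul, norm_pow]
    exact mul_le_one₀ (pow_le_one₀ (norm_nonneg _) (mem_ball_zero_iff.1 hz).le) (norm_nonneg _)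
      (hb z hz)
  refine ⟨DifferentiableOn.moebius hx ((differentiableOn_id.pow 2).mul hg) hk,
    fun z hz => norm_moebius_le_one hx (hk z hz), ?_⟩
  have h0 : HasDerivAt (fun z : ℂ => z ^ 2 * g z) 0 0 := by
    have hg0 : DifferentiableAt ℂ g 0 :=
      hg.differentiableAt (Metric.ball_mem_nhds _ one_pos)
    exact ((hasDerivAt_pow 2 (0 : ℂ)).mul hg0.hasDerivAt).congr_deriv (by simp)
  exact (((h0.const_add x).div ((h0.const_mul (star x)).const_add 1) (by simp)).congr_deriv
    (by simp)).deriv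

/-- Interpolation of three values, the one at the origin with multiplicity two. -/
theorem mem_interpolationBody_of_pick_le {z₁ w₁ z₀ w x : ℂ} (hz₁ : ‖z₁‖ < 1) (hz₁0 : z₁ ≠ 0)
    (hz₀ : ‖z₀‖ < 1) (hz₀0 : z₀ ≠ 0) (hx : ‖x‖ < 1) (hw₁ : ‖w₁‖ < 1) (hw : ‖w‖ ≤ 1)
    (hd : ‖w₁ - x‖ ^ 2 < ‖z₁‖ ^ 4 * ‖1 - star x * w₁‖ ^ 2)
    (h : (1 - ‖z₁‖ ^ 2) * (1 - ‖z₀‖ ^ 2) * ‖(1 - x * star w₁) * (1 - star x * w) *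
        star z₁ ^ 2 * z₀ ^ 2 - star (w₁ - x) * (w - x)‖ ^ 2 ≤
      (‖z₁‖ ^ 4 * ‖1 - star x * w₁‖ ^ 2 - ‖w₁ - x‖ ^ 2) *
        (‖z₀‖ ^ 4 * ‖1 - star x * w‖ ^ 2 - ‖w - x‖ ^ 2) * ‖1 - star z₁ * z₀‖ ^ 2) :
    w ∈ interpolationBody z₁ w₁ z₀ := by
  have hne : ∀ {v : ℂ}, ‖v‖ ≤ 1 → 1 - star x * v ≠ 0 := fun {v} hv => by
    have := one_add_star_mul_ne_zero (a := -x) (ζ := v) (by simpa using hx) hv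
    simpa [sub_eq_add_neg] using this
  have hu := hne hw₁.le
  have hv := hne hw
  have hu' : 1 - x * star w₁ ≠ 0 := by
    have := star_ne_zero.2 hu
    simpa [mul_comm] using this
  obtain ⟨g, hgd, hgb, hg1, hg0⟩ := exists_schur_two_point hz₁ hz₀
    (γ₁ := (w₁ - x) / (1 - star x * w₁) / z₁ ^ 2) (γ₀ := (w - x) / (1 - star x * w) / z₀ ^ 2)
    (by
      have : ‖(w₁ - x) / (1 - star x * w₁) / z₁ ^ 2‖ ^ 2 < 1 := by
        rw [norm_div, norm_div, norm_pow, div_pow, div_pow, div_div, div_lt_one (by positivity)]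
        linarith
      nlinarith [norm_nonneg ((w₁ - x) / (1 - star x * w₁) / z₁ ^ 2)])
    (by
      have e1 : 1 - star ((w₁ - x) / (1 - star x * w₁) / z₁ ^ 2) * ((w - x) / (1 - star x * w) / z₀ ^ 2)
          = ((1 - x * star w₁) * (1 - star x * w) *
        star z₁ ^ 2 * z₀ ^ 2 - star (w₁ - x) * (w - x)) /
          ((1 - x * star w₁) * (1 - star x * w) * star z₁ ^ 2 * z₀ ^ 2) := by
        have : star z₁ ≠ 0 := star_ne_zero.2 hz₁0
        have hv' : 1 - w * star x ≠ 0 := by rwa [mul_comm]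
        rw [star_div₀, star_div₀, star_sub 1, star_mul, star_star, star_one, star_pow,
          mul_comm (star w₁) x]
        field_simp
      have e2 : ‖1 - x * star w₁‖ = ‖1 - star x * w₁‖ := by
        rw [← norm_star]; simp [mul_comm]
      have hun : 0 < ‖1 - star x * w₁‖ := norm_pos_iff.2 hu
      have hvn : 0 < ‖1 - star x * w‖ := norm_pos_iff.2 hv
      have hz1n : 0 < ‖z₁‖ := norm_pos_iff.2 hz₁0
      have hz0n : 0 < ‖z₀‖ := norm_pos_iff.2 hz₀0
      rw [e1]
      simp only [norm_div, norm_mul, norm_pow, norm_star, e2] at h ⊢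
      have := div_le_div_of_nonneg_right h
        (by positivity : 0 ≤ (‖1 - star x * w₁‖ * ‖1 - star x * w‖ * ‖z₁‖ ^ 2 * ‖z₀‖ ^ 2) ^ 2)
      generalize ‖1 - star x * w₁‖ = U at *
      generalize ‖1 - star x * w‖ = V at *
      refine le_of_eq_of_le ?_ (this.trans_eq ?_)
      · ring
      · generalize ‖z₁‖ = X at *
        generalize ‖z₀‖ = Y at *
        field_simp)
  refine ⟨_, moebius_sq_mul_mem_schurClassOne hx hgd hgb, ?_, ?_⟩
  · simp only [hg1]
    rw [mul_div_cancel₀ _ (pow_ne_zero 2 hz₁0), moebius_div hx hu]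
  · simp only [hg0]
    rw [mul_div_cancel₀ _ (pow_ne_zero 2 hz₀0), moebius_div hx hv]

open scoped ComplexOrder

/-- If `w` lies in the disk given by the rank-one update `P + W W*`, the Schur complement
`1 - |w|² - (E + conj w W)* P⁻¹ (E + conj w W)` is nonnegative. -/
theorem exists_mulVec_eq_of_norm_sub_le {n : Type*} [Fintype n] [DecidableEq n]
    {P : Matrix n n ℂ} (hP : P.PosDef) {E W : n → ℂ} {c w : ℂ} {l r : ℝ}
    (hc : c = -(star E ⬝ᵥ ((P + Matrix.vecMulVec W (star W))⁻¹ *ᵥ W)))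
    (hl : (l : ℂ) = 1 - star W ⬝ᵥ ((P + Matrix.vecMulVec W (star W))⁻¹ *ᵥ W))
    (hr : (r : ℂ) = 1 - star E ⬝ᵥ ((P + Matrix.vecMulVec W (star W))⁻¹ *ᵥ E))
    (hr0 : 0 ≤ r) (hw : ‖w - c‖ ≤ √l * √r) :
    ∃ ξ : n → ℂ, P *ᵥ ξ = E + star w • W ∧
      (star (E + star w • W) ⬝ᵥ ξ).re ≤ 1 - ‖w‖ ^ 2 := by
  set A := P + Matrix.vecMulVec W (star W) with hA
  have hApos : A.PosDef := hP.add_posSemidef (Matrix.posSemidef_vecMulVec_self_star W)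
  have hAu : IsUnit A.det := (Matrix.isUnit_iff_isUnit_det A).1 hApos.isUnit
  have hsolve : ∀ v, P *ᵥ (A⁻¹ *ᵥ v) = v - (star W ⬝ᵥ (A⁻¹ *ᵥ v)) • W := fun v => by
    have h1 : A *ᵥ (A⁻¹ *ᵥ v) = v := by
      rw [Matrix.mulVec_mulVec, Matrix.mul_nonsing_inv A hAu, Matrix.one_mulVec]
    rw [eq_sub_iff_add_eq]
    rw [hA, Matrix.add_mulVec, Matrix.vecMulVec_mulVec] at h1
    simpa using h1
  have hWE : star W ⬝ᵥ (A⁻¹ *ᵥ E) = -star c := by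
    rw [hc, star_neg, neg_neg, ← Matrix.star_dotProduct, Matrix.star_mulVec,
      hApos.isHermitian.inv.eq, ← Matrix.dotProduct_mulVec]
  set α := A⁻¹ *ᵥ W with hα
  set β := A⁻¹ *ᵥ E with hβ
  have hWW : star W ⬝ᵥ α = 1 - l := by rw [hl]; ring
  have hEW : star E ⬝ᵥ α = -c := by rw [hc]; ring
  have hEE : star E ⬝ᵥ β = 1 - r := by rw [hr]; ring
  have hPα : P *ᵥ α = (l : ℂ) • W := by
    rw [hα, hsolve, ← hα, hWW]
    module
  have hPβ : P *ᵥ β = E + star c • W := by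
    rw [hβ, hsolve, ← hβ, hWE]
    module
  have hαW : star α ⬝ᵥ W = 1 - l := by
    rw [Matrix.star_dotProduct, hWW]
    simp
  have hl0 : 0 < l := by
    have hlne : l ≠ 0 := by
      rintro rfl
      have h0 : α = 0 := by
        by_contra hne
        have := hP.dotProduct_mulVec_pos hne
        simp [hPα] at this
      rw [h0] at hWW
      simp at hWW
    have h := hP.posSemidef.dotProduct_mulVec_nonneg α
    rw [hPα, dotProduct_smul, hαW, smul_eq_mul] at h
    have h' : 0 ≤ l * (1 - l) := by exact_mod_cast h
    rcases lt_or_gt_of_ne hlne with h2 | h2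
    · nlinarith
    · exact h2
  have hlC : (l : ℂ) ≠ 0 := by exact_mod_cast hl0.ne'
  refine ⟨β + (star (w - c) / l) • α, ?_, ?_⟩
  · rw [Matrix.mulVec_add, Matrix.mulVec_smul, hPα, hPβ, smul_smul, div_mul_cancel₀ _ hlC, star_sub]
    module
  · have hval : star (E + star w • W) ⬝ᵥ (β + (star (w - c) / l) • α) =
        ((1 - ‖w‖ ^ 2 - r + ‖w - c‖ ^ 2 / l : ℝ) : ℂ) := by
      simp only [star_add, star_smul, star_star, add_dotProduct, dotProduct_add, smul_dotProduct,
        dotProduct_smul, hWW, hEW, hEE, hWE, smul_eq_mul]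
      push_cast
      rw [← Complex.mul_conj', ← Complex.mul_conj', star_sub, map_sub]
      simp only [← starRingEnd_apply]
      field_simp
      ring
    rw [hval, Complex.ofReal_re]
    have : ‖w - c‖ ^ 2 / l ≤ r := by
      rw [div_le_iff₀ hl0]
      calc ‖w - c‖ ^ 2 ≤ (√l * √r) ^ 2 := by gcongr
        _ = r * l := by rw [mul_pow, Real.sq_sqrt hl0.le, Real.sq_sqrt hr0]; ring
    linarith

/-- `(1 - |x|²)` times the Schur complement of the upper left block of the Pick matrix, times
`1 - |z₁|²`. -/
noncomputable def pickSchur (z₁ w₁ x : ℂ) : ℝ :=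
  ‖z₁‖ ^ 4 * ‖1 - star x * w₁‖ ^ 2 - ‖w₁ - x‖ ^ 2

theorem pickSchur_pos_of_mem_ball {z₁ w₁ x : ℂ} (hz₁ : ‖z₁‖ < 1) (hw₁ : ‖w₁‖ < 1)
    (hx : x ∈ Metric.ball (paramCenter z₁ w₁) (paramRadius z₁ w₁)) : 0 < pickSchur z₁ w₁ x := by
  have hz4 : ‖z₁‖ ^ 4 < 1 := pow_lt_one₀ (norm_nonneg _) hz₁ (by norm_num)
  have hw2 : ‖w₁‖ ^ 2 < 1 := pow_lt_one₀ (norm_nonneg _) hw₁ (by norm_num)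
  have hD : 0 < 1 - ‖z₁‖ ^ 4 * ‖w₁‖ ^ 2 := by nlinarith [sq_nonneg ‖w₁‖, sq_nonneg (‖z₁‖ ^ 2)]
  have hDC : (1 - (‖z₁‖ : ℂ) ^ 4 * (‖w₁‖ : ℂ) ^ 2) ≠ 0 := by exact_mod_cast hD.ne'
  rw [mem_ball_iff_norm] at hx
  have e : x - paramCenter z₁ w₁ = (x * ((1 - ‖z₁‖ ^ 4 * ‖w₁‖ ^ 2 : ℝ) : ℂ) -
      w₁ * ((1 - ‖z₁‖ ^ 4 : ℝ) : ℂ)) / ((1 - ‖z₁‖ ^ 4 * ‖w₁‖ ^ 2 : ℝ) : ℂ) := by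
    rw [paramCenter]
    push_cast
    field_simp
  rw [e, norm_div, Complex.norm_real, Real.norm_of_nonneg hD.le, paramRadius,
    div_lt_div_iff_of_pos_right hD] at hx
  have h2 := pow_lt_pow_left₀ hx (norm_nonneg _) two_ne_zero
  have key : (1 - ‖z₁‖ ^ 4 * ‖w₁‖ ^ 2) * pickSchur z₁ w₁ x =
      (‖z₁‖ ^ 2 * (1 - ‖w₁‖ ^ 2)) ^ 2 - ‖x * ((1 - ‖z₁‖ ^ 4 * ‖w₁‖ ^ 2 : ℝ) : ℂ) -
      w₁ * ((1 - ‖z₁‖ ^ 4 : ℝ) : ℂ)‖ ^ 2 := by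
    rw [pickSchur]
    have hz : ‖z₁‖ ^ 4 = (‖z₁‖ ^ 2) ^ 2 := by ring
    rw [hz]
    generalize ‖z₁‖ ^ 2 = ρ
    simp only [Complex.sq_norm, Complex.normSq_apply, Complex.sub_re, Complex.sub_im,
      Complex.mul_re, Complex.mul_im, Complex.ofReal_re, Complex.ofReal_im, Complex.one_re,
      Complex.one_im, Complex.star_def, Complex.conj_re, Complex.conj_im]
    ring
  exact pos_of_mul_pos_right (by rw [key]; linarith) hD.le

theorem norm_lt_one_of_pickSchur_pos {z₁ w₁ x : ℂ} (hz₁ : ‖z₁‖ < 1) (hw₁ : ‖w₁‖ < 1)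
    (h : 0 < pickSchur z₁ w₁ x) : ‖x‖ < 1 := by
  have hz4 : ‖z₁‖ ^ 4 < 1 := pow_lt_one₀ (norm_nonneg _) hz₁ (by norm_num)
  have h1 := moebius_denom_sq_sub x w₁
  have h2 : 0 < (1 - ‖x‖ ^ 2) * (1 - ‖w₁‖ ^ 2) := by
    rw [← h1]
    rw [pickSchur] at h
    nlinarith [sq_nonneg ‖1 - star x * w₁‖]
  have h3 := pos_of_mul_pos_left h2 (by nlinarith [norm_nonneg w₁])
  nlinarith [norm_nonneg x]

theorem pickMatrix_isHermitian (z₁ w₁ x : ℂ) : (pickMatrix z₁ w₁ x).IsHermitian := by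
  ext i j
  fin_cases i <;> fin_cases j <;> simp [pickMatrix, mul_comm]

/-- Completing squares in the Hermitian form of the Pick matrix. -/
theorem pickMatrix_quadForm {z₁ : ℂ} (w₁ x : ℂ) (hz₁ : ‖z₁‖ < 1) (v : Fin 3 → ℂ) :
    (1 - (‖x‖ : ℂ) ^ 2) * (star v ⬝ᵥ (pickMatrix z₁ w₁ x *ᵥ v)) =
      ((‖(pickMatrix z₁ w₁ x *ᵥ v) 0‖ ^ 2 + ‖(pickMatrix z₁ w₁ x *ᵥ v) 1‖ ^ 2 +
        pickSchur z₁ w₁ x / (1 - ‖z₁‖ ^ 2) * ‖v 2‖ ^ 2 : ℝ) : ℂ) := by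
  have h1 : (1 - ‖z₁‖ ^ 2 : ℝ) ≠ 0 := by nlinarith [norm_nonneg z₁]
  have h1C : (1 - (‖z₁‖ : ℂ) ^ 2) ≠ 0 := by exact_mod_cast h1
  rw [pickSchur]
  push_cast
  simp only [pickMatrix, Matrix.mulVec, dotProduct, Fin.sum_univ_three, Matrix.of_apply,
    Matrix.cons_val, Pi.star_apply]
  have hz4 : (‖z₁‖ : ℂ) ^ 4 = ((‖z₁‖ : ℂ) ^ 2) ^ 2 := by ring
  rw [hz4]
  simp only [← Complex.mul_conj'] at h1C ⊢
  simp only [← starRingEnd_apply, map_add, map_sub, map_mul, map_one, Complex.conj_conj, map_zero]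
  have h1C' : 1 - (starRingEnd ℂ) z₁ * z₁ ≠ 0 := by rwa [mul_comm]
  field_simp
  ring

theorem pickMatrix_posDef {z₁ w₁ x : ℂ} (hz₁ : ‖z₁‖ < 1) (hx : ‖x‖ < 1)
    (h : 0 < pickSchur z₁ w₁ x) : (pickMatrix z₁ w₁ x).PosDef := by
  refine .of_dotProduct_mulVec_pos (pickMatrix_isHermitian z₁ w₁ x) fun v hv => ?_
  have hp : 0 < 1 - ‖x‖ ^ 2 := by nlinarith [norm_nonneg x]
  have hq : 0 < 1 - ‖z₁‖ ^ 2 := by nlinarith [norm_nonneg z₁]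
  have hquad := pickMatrix_quadForm w₁ x hz₁ v
  have hs : 0 < pickSchur z₁ w₁ x / (1 - ‖z₁‖ ^ 2) := div_pos h hq
  have hpos : 0 < ‖(pickMatrix z₁ w₁ x *ᵥ v) 0‖ ^ 2 + ‖(pickMatrix z₁ w₁ x *ᵥ v) 1‖ ^ 2 +
        pickSchur z₁ w₁ x / (1 - ‖z₁‖ ^ 2) * ‖v 2‖ ^ 2 := by
    by_cases h2 : v 2 = 0
    · have hpC : (1 - (‖x‖ : ℂ) ^ 2) ≠ 0 := by exact_mod_cast hp.ne'
      have e0 : (pickMatrix z₁ w₁ x *ᵥ v) 0 = (1 - (‖x‖ : ℂ) ^ 2) * v 0 := by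
        simp [pickMatrix, Matrix.mulVec, dotProduct, Fin.sum_univ_three, h2]
      have e1 : (pickMatrix z₁ w₁ x *ᵥ v) 1 = (1 - (‖x‖ : ℂ) ^ 2) * v 1 := by
        simp [pickMatrix, Matrix.mulVec, dotProduct, Fin.sum_univ_three, h2]
      rw [e0, e1, h2]
      by_cases h0 : v 0 = 0
      · have h1 : v 1 ≠ 0 := fun h1 => hv (by ext i; fin_cases i <;> assumption)
        have := mul_ne_zero hpC h1
        positivity
      · have := mul_ne_zero hpC h0
        positivity
    · positivity
  have : star v ⬝ᵥ (pickMatrix z₁ w₁ x *ᵥ v) = (((‖(pickMatrix z₁ w₁ x *ᵥ v) 0‖ ^ 2 +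
      ‖(pickMatrix z₁ w₁ x *ᵥ v) 1‖ ^ 2 +
        pickSchur z₁ w₁ x / (1 - ‖z₁‖ ^ 2) * ‖v 2‖ ^ 2) / (1 - ‖x‖ ^ 2) : ℝ) : ℂ) := by
    rw [Complex.ofReal_div, ← hquad]
    push_cast
    rw [mul_div_cancel_left₀]
    exact_mod_cast hp.ne'
  rw [this]
  exact_mod_cast div_pos hpos hp

/-- The last coordinate of a solution of the linear system with the Pick matrix. -/
theorem pickSchur_mul_eq {z₁ w₁ x : ℂ} (hz₁ : ‖z₁‖ < 1) (v : Fin 3 → ℂ) :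
    (pickSchur z₁ w₁ x / (1 - ‖z₁‖ ^ 2) : ℝ) * v 2 =
      (1 - (‖x‖ : ℂ) ^ 2) * (pickMatrix z₁ w₁ x *ᵥ v) 2 -
        (1 - w₁ * star x) * ((pickMatrix z₁ w₁ x *ᵥ v) 0 + z₁ * (pickMatrix z₁ w₁ x *ᵥ v) 1) := by
  have h1 : (1 - ‖z₁‖ ^ 2 : ℝ) ≠ 0 := by nlinarith [norm_nonneg z₁]
  have h1C : (1 - (‖z₁‖ : ℂ) ^ 2) ≠ 0 := by exact_mod_cast h1
  rw [pickSchur]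
  push_cast
  simp only [pickMatrix, Matrix.mulVec, dotProduct, Fin.sum_univ_three, Matrix.of_apply,
    Matrix.cons_val]
  have hz4 : (‖z₁‖ : ℂ) ^ 4 = ((‖z₁‖ : ℂ) ^ 2) ^ 2 := by ring
  rw [hz4]
  simp only [← Complex.mul_conj'] at h1C ⊢
  simp only [← starRingEnd_apply, map_sub, map_mul, map_one, Complex.conj_conj]
  field_simp
  ring

theorem mem_interpolationBody_of_mem_disk {z₁ w₁ z₀ x w : ℂ} (hz₁ : ‖z₁‖ < 1) (hz₁0 : z₁ ≠ 0)
    (hz₀ : ‖z₀‖ < 1) (hz₀0 : z₀ ≠ 0) (hw₁ : ‖w₁‖ < 1) (hS : 0 < pickSchur z₁ w₁ x)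
    (hrho : 0 < rho z₁ w₁ z₀ x)
    (hw : ‖w - diskCenter z₁ w₁ z₀ x‖ ≤ diskRadius z₁ w₁ z₀ x) :
    w ∈ interpolationBody z₁ w₁ z₀ := by
  have hx := norm_lt_one_of_pickSchur_pos hz₁ hw₁ hS
  obtain ⟨ξ, hξ, hle⟩ := exists_mulVec_eq_of_norm_sub_le (pickMatrix_posDef hz₁ hx hS)
    (c := diskCenter z₁ w₁ z₀ x) rfl (ofReal_ell z₁ w₁ z₀ x) (ofReal_rho z₁ w₁ z₀ x) hrho.le hw
  have hp : 0 < 1 - ‖x‖ ^ 2 := by nlinarith [norm_nonneg x]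
  have hδ : 0 < 1 - ‖z₀‖ ^ 2 := by nlinarith [norm_nonneg z₀]
  have hδ₁ : 0 < 1 - ‖z₁‖ ^ 2 := by nlinarith [norm_nonneg z₁]
  have hsq : ‖sqrtDelta z₀‖ ^ 2 = 1 - ‖z₀‖ ^ 2 := by
    rw [Real.norm_eq_abs, sq_abs, sqrtDelta, Real.sq_sqrt hδ.le]
  have hd : 1 - star z₀ * z₁ ≠ 0 := by
    have := one_add_star_mul_ne_zero (a := -z₀) (ζ := z₁) (by simpa using hz₀) hz₁.le
    simpa [sub_eq_add_neg] using this
  have y0 : (pickMatrix z₁ w₁ x *ᵥ ξ) 0 = sqrtDelta z₀ * (1 - star w * x) := by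
    rw [hξ]; simp [vecE, vecW]; ring
  have y1 : (pickMatrix z₁ w₁ x *ᵥ ξ) 1 = sqrtDelta z₀ * (star z₀ * (1 - star w * x)) := by
    rw [hξ]; simp [vecE, vecW]; ring
  have y2 : (pickMatrix z₁ w₁ x *ᵥ ξ) 2 =
      sqrtDelta z₀ * ((1 - star w * w₁) / (1 - star z₀ * z₁)) := by
    rw [hξ]; simp [vecE, vecW]; ring
  set N : ℂ := (1 - x * star w₁) * (1 - star x * w) * star z₁ ^ 2 * z₀ ^ 2 -
    star (w₁ - x) * (w - x) with hN
  set σ : ℝ := pickSchur z₁ w₁ x / (1 - ‖z₁‖ ^ 2) with hσ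
  have hσ0 : 0 < σ := div_pos hS hδ₁
  have hSσ : pickSchur z₁ w₁ x = σ * (1 - ‖z₁‖ ^ 2) := by rw [hσ, div_mul_cancel₀ _ hδ₁.ne']
  have hlast : (σ : ℂ) * ξ 2 = sqrtDelta z₀ * (star N / (1 - star z₀ * z₁)) := by
    rw [hσ, pickSchur_mul_eq hz₁, y0, y1, y2, hN, ← Complex.mul_conj']
    simp only [← starRingEnd_apply, map_sub, map_mul, map_pow, map_one, Complex.conj_conj]
    rw [← starRingEnd_apply] at hd
    field_simp
    ring
  have hlast2 : σ ^ 2 * ‖ξ 2‖ ^ 2 * ‖1 - star z₁ * z₀‖ ^ 2 = (1 - ‖z₀‖ ^ 2) * ‖N‖ ^ 2 := by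
    have h := congrArg (fun t => ‖t‖ ^ 2) hlast
    have hd' : ‖1 - star z₁ * z₀‖ = ‖1 - star z₀ * z₁‖ := by
      rw [← norm_star]; simp [mul_comm]
    simp only [norm_mul, norm_div, norm_star, mul_pow, div_pow, hsq, Complex.norm_real,
      Real.norm_of_nonneg hσ0.le] at h
    rw [h, hd', mul_assoc, div_mul_cancel₀]
    exact pow_ne_zero 2 (norm_ne_zero_iff.2 hd)
  have hV : ‖1 - star w * x‖ = ‖1 - star x * w‖ := by
    rw [← norm_star]; simp [mul_comm]
  have hschur : σ * ‖ξ 2‖ ^ 2 ≤ ‖z₀‖ ^ 4 * ‖1 - star x * w‖ ^ 2 - ‖w - x‖ ^ 2 := by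
    have hquad := pickMatrix_quadForm w₁ x hz₁ ξ
    rw [y0, y1] at hquad
    simp only [norm_mul, mul_pow, norm_star, Complex.norm_real, hsq, hV, ← hσ] at hquad
    have hre := congrArg Complex.re hquad
    rw [show (1 - (‖x‖ : ℂ) ^ 2) = ((1 - ‖x‖ ^ 2 : ℝ) : ℂ) by push_cast; rfl,
      Complex.re_ofReal_mul, Complex.ofReal_re] at hre
    rw [← hξ, Matrix.star_dotProduct, Complex.star_def, Complex.conj_re] at hle
    have := mul_le_mul_of_nonneg_left hle hp.le
    rw [hre, ← moebius_denom_sq_sub] at this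
    linarith
  have hpos : 0 ≤ σ * ‖ξ 2‖ ^ 2 := by positivity
  have hw1 : ‖w‖ ≤ 1 := by
    have h4 : ‖z₀‖ ^ 4 ≤ 1 := pow_le_one₀ (norm_nonneg _) hz₀.le
    have h := moebius_denom_sq_sub x w
    have h' : 0 ≤ (1 - ‖x‖ ^ 2) * (1 - ‖w‖ ^ 2) := by
      nlinarith [sq_nonneg ‖1 - star x * w‖]
    have := nonneg_of_mul_nonneg_right h' hp
    nlinarith [norm_nonneg w]
  refine mem_interpolationBody_of_pick_le hz₁ hz₁0 hz₀ hz₀0 hx hw₁ hw1 (sub_pos.1 hS) ?_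
  change _ ≤ pickSchur z₁ w₁ x * _ * _
  rw [hSσ]
  calc (1 - ‖z₁‖ ^ 2) * (1 - ‖z₀‖ ^ 2) * ‖N‖ ^ 2
      = σ * (1 - ‖z₁‖ ^ 2) * (σ * ‖ξ 2‖ ^ 2) * ‖1 - star z₁ * z₀‖ ^ 2 := by
        linear_combination -(1 - ‖z₁‖ ^ 2) * hlast2
    _ ≤ _ := by gcongr

theorem norm_lt_one_of_mem_ball {z₁ w₁ x : ℂ} (hw₁ : ‖w₁‖ ≤ 1)
    (hx : x ∈ Metric.ball (paramCenter z₁ w₁) (paramRadius z₁ w₁)) : ‖w₁‖ < 1 := by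
  refine lt_of_le_of_ne hw₁ fun h => ?_
  have := Metric.pos_of_mem_ball hx
  simp [paramRadius, h] at this

end ConstrainedInterpolation

theorem proposition5p1 (z₁ w₁ z₀ : ℂ) (hz₁ : ‖z₁‖ < 1) (hz₁0 : z₁ ≠ 0)
    (hz₀ : ‖z₀‖ < 1) (hz₀0 : z₀ ≠ 0) (hw₁ : ‖w₁‖ ≤ 1) :
    (∀ x ∈ Metric.ball (ConstrainedInterpolation.paramCenter z₁ w₁)
        (ConstrainedInterpolation.paramRadius z₁ w₁),
      IsUnit (ConstrainedInterpolation.augMatrix z₁ w₁ z₀ x)) ∧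
    (⋃ x ∈ {x : ℂ | x ∈ Metric.ball (ConstrainedInterpolation.paramCenter z₁ w₁)
          (ConstrainedInterpolation.paramRadius z₁ w₁) ∧
          0 < ConstrainedInterpolation.rho z₁ w₁ z₀ x},
      Metric.closedBall (ConstrainedInterpolation.diskCenter z₁ w₁ z₀ x)
        (ConstrainedInterpolation.diskRadius z₁ w₁ z₀ x)) ⊆
      ConstrainedInterpolation.interpolationBody z₁ w₁ z₀ := by
  open ConstrainedInterpolation in
  open scoped ComplexOrder in
  refine ⟨fun x hx => ?_, Set.iUnion₂_subset fun x hx w hw => ?_⟩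
  · have hw₁' := norm_lt_one_of_mem_ball hw₁ hx
    have hS := pickSchur_pos_of_mem_ball hz₁ hw₁' hx
    exact ((pickMatrix_posDef hz₁ (norm_lt_one_of_pickSchur_pos hz₁ hw₁' hS) hS).add_posSemidef
      (Matrix.posSemidef_vecMulVec_self_star _)).isUnit
  · have hw₁' := norm_lt_one_of_mem_ball hw₁ hx.1
    exact mem_interpolationBody_of_mem_disk hz₁ hz₁0 hz₀ hz₀0 hw₁'
      (pickSchur_pos_of_mem_ball hz₁ hw₁' hx.1) hx.2 (mem_closedBall_iff_norm.1 hw)
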